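/- All rings are associative with unit. In a ring $R$, two elements $x,y$ are called centrally orthogonal, $x\perp y$, if $xRy=0$ and $yRx=0$. An element $u\in R$ is quasi-invertible if there are $a,b\in R$ with $(1-ua)\perp(1-bu)$; write $R_q^{-1}$ for the set of quasi-invertible elements. The ring $R$ is called a QB-ring if, whenever $a,b,x\in R$ satisfy $xa+b=1$, there is $y\in R$ such that $a+yb\in R_q^{-1}$. Two rings are called Morita equivalent if there is an additive equivalence between their categories of left modules. Corollary 6.6. Let $R$ and $S$ be unital rings. If $R$ is a QB-ring and $S$ is Morita equivalent to $R$, then $S$ is also a QB-ring. -/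

import Mathlib

universe u v

/-- Two elements `x`, `y` of a ring are centrally orthogonal, `x ⟂ y`, if `xRy = 0` and
`yRx = 0`. -/
def CentrallyOrthogonal {R : Type*} [Ring R] (x y : R) : Prop :=
  (∀ r : R, x * r * y = 0) ∧ (∀ r : R, y * r * x = 0)

/-- An element `u` of a unital ring is quasi-invertible if `(1 - ua) ⟂ (1 - bu)` for some
elements `a`, `b` of the ring. -/
def IsQuasiInvertible {R : Type*} [Ring R] (u : R) : Prop :=
  ∃ a b : R, CentrallyOrthogonal (1 - u * a) (1 - b * u)

/-- `leftCl A` is the set of all `a` such that whenever `xa + b = 1` there is a `y`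
with `a + yb ∈ A`. -/
def leftCl {R : Type*} [Ring R] (A : Set R) : Set R :=
  {a | ∀ x b : R, x * a + b = 1 → ∃ y : R, a + y * b ∈ A}

/-- A unital ring is a QB-ring if every element lies in the closure, in the sense of `leftCl`, of
the set of quasi-invertible elements. -/
def IsQBRing (R : Type*) [Ring R] : Prop :=
  leftCl {u : R | IsQuasiInvertible u} = Set.univ

/-!
A ring Morita equivalent to `R` is a corner `E Mₙ(R) E` of a matrix ring over `R`, so it suffices
that the QB-property passes to corners and to matrix rings.

For a corner `eTe`, a relation `xa + b = e` extends to the relation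
`(x + 1 - e)(a + 1 - e) + b = 1` in `T`; its completion becomes block diagonal after one elementary
column operation, and compressing quasi-inverses to `eTe` preserves central orthogonality
(`IsQBRing.of_corner`).

For matrices it is enough to treat `M₂(R)` (`IsQBRing.matrix_fin_two`): iterating gives arbitrarily
large matrix rings, and the others are corners of these. Given a relation `XA + ZB = 1` in `M₂(R)`,
elementary row and column operations and additions of multiples of `B` turn the diagonal entries
`u`, `w` of `A` into quasi-invertible elements, with quasi-inverses `v`, `z` and centrally orthogonal
defects `p = 1 - uv`, `q = 1 - vu` and `s = 1 - wz`, `t = 1 - zw`. Unlike in rings of stable rank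
one, the other entries cannot be cleared: they only shrink to the skew corners `pRt` and `sRq`. There
they can in turn be made quasi-invertible (`IsQBRing.exists_skewCorner`), and then the entrywise
quasi-inverses, transposed, form a quasi-inverse of the matrix (`isQuasiInvertible_fin_two`).

The Morita part uses only that an equivalence carries the generator `R` to a generator `M` of the
category of `S`-modules with the same endomorphism ring: the trace ideal of `M` is `S`, which factors
the identity of `S` as a finite sum of maps through `M`.
-/


/-! ### Quasi-inverses -/

section QuasiInverse

variable {R : Type*} [Ring R]

/-- `v` is a quasi-inverse of `u`, with defect idempotents `p = 1 - uv` and `q = 1 - vu`: these are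
centrally orthogonal, and `u` and `v` are inverse to each other away from `p` and `q`. -/
structure IsQuasiInverse (u v p q : R) : Prop where
  mul_left : u * v = 1 - p
  mul_right : v * u = 1 - q
  p_mul : p * u = 0
  mul_q : u * q = 0
  mul_p : v * p = 0
  q_mul : q * v = 0
  pq : ∀ r, p * r * q = 0
  qp : ∀ r, q * r * p = 0

namespace IsQuasiInverse

variable {u v p q : R}

theorem p_sq (h : IsQuasiInverse u v p q) : p * p = p := by
  have : (1 - p) * p = 0 := by rw [← h.mul_left, mul_assoc, h.mul_p, mul_zero]
  rw [sub_mul, one_mul, sub_eq_zero] at this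
  exact this.symm

theorem q_sq (h : IsQuasiInverse u v p q) : q * q = q := by
  have : (1 - q) * q = 0 := by rw [← h.mul_right, mul_assoc, h.mul_q, mul_zero]
  rw [sub_mul, one_mul, sub_eq_zero] at this
  exact this.symm

end IsQuasiInverse

/-- A quasi-invertible element has a two-sided quasi-inverse that is also a generalized inverse in
the sense of von Neumann. -/
theorem IsQuasiInvertible.exists_isQuasiInverse {u : R} (h : IsQuasiInvertible u) :
    ∃ v p q, IsQuasiInverse u v p q := by
  obtain ⟨a, b, h1, h2⟩ := h
  -- `1 - uc = (1 - ub)(1 - ua)` and `1 - cu = (1 - bu)(1 - au)`, so the defects of `c` on both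
  -- sides stay centrally orthogonal.
  obtain ⟨c, hc⟩ : ∃ c, c = a + b - b * u * a := ⟨_, rfl⟩
  have e1 : 1 - u * c = (1 - u * b) * (1 - u * a) := by rw [hc]; noncomm_ring
  have e2 : 1 - c * u = (1 - b * u) * (1 - a * u) := by rw [hc]; noncomm_ring
  have o1 : ∀ r, (1 - u * c) * r * (1 - c * u) = 0 := fun r => by
    have := h1 r
    calc _ = (1 - u * b) * ((1 - u * a) * r * (1 - b * u)) * (1 - a * u) := by
            rw [e1, e2]; simp only [mul_assoc]
      _ = 0 := by rw [this, mul_zero, zero_mul]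
  have o2 : ∀ r, (1 - c * u) * r * (1 - u * c) = 0 := fun r => by
    have := h2 ((1 - a * u) * r * (1 - u * b))
    calc _ = (1 - b * u) * ((1 - a * u) * r * (1 - u * b)) * (1 - u * a) := by
            rw [e1, e2]; simp only [mul_assoc]
      _ = 0 := this
  have hu : u * c * u * c * u = 2 * (u * c * u) - u := by
    have := o1 u
    rw [← sub_eq_zero, ← this]; noncomm_ring
  -- Two standard corrections turn `c` into a reflexive generalized inverse `v` of `u`.
  obtain ⟨d, hd⟩ : ∃ d, d = 2 * c - c * u * c := ⟨_, rfl⟩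
  have f1 : 1 - u * d = (1 - u * c) * (1 - u * c) := by rw [hd]; noncomm_ring
  have f2 : 1 - d * u = (1 - c * u) * (1 - c * u) := by rw [hd]; noncomm_ring
  have hud : u * d * u = u := by
    have : u * d * u = 2 * (u * c * u) - u * c * u * c * u := by rw [hd]; noncomm_ring
    rw [this, hu]; abel
  have g1 : u * (d * u * d) = u * d := by rw [← mul_assoc, ← mul_assoc, hud]
  have g2 : d * u * d * u = d * u := by rw [mul_assoc, mul_assoc, ← mul_assoc u, hud]
  have hdu : d * u * d * u * d = d * u * d := by rw [g2]
  refine ⟨d * u * d, 1 - u * d, 1 - d * u, ?_, ?_, ?_, ?_, ?_, ?_, ?_, ?_⟩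
  · rw [g1]; abel
  · rw [g2]; abel
  · rw [sub_mul, hud, one_mul, sub_self]
  · rw [mul_sub, ← mul_assoc, hud, mul_one, sub_self]
  · rw [mul_sub, mul_one, ← mul_assoc, hdu, sub_self]
  · rw [sub_mul, one_mul, ← mul_assoc, ← mul_assoc, hdu, sub_self]
  · intro r
    calc _ = (1 - u * c) * ((1 - u * c) * r * (1 - c * u)) * (1 - c * u) := by
            rw [f1, f2]; simp only [mul_assoc]
      _ = 0 := by rw [o1]
  · intro r
    calc _ = (1 - c * u) * ((1 - c * u) * r * (1 - u * c)) * (1 - u * c) := by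
            rw [f1, f2]; simp only [mul_assoc]
      _ = 0 := by rw [o2]

theorem IsQuasiInvertible.units_mul_mul {a : R} (h : IsQuasiInvertible a) (U V : Rˣ) :
    IsQuasiInvertible (U * a * V) := by
  obtain ⟨x, y, h1, h2⟩ := h
  refine ⟨↑V⁻¹ * x * ↑U⁻¹, ↑V⁻¹ * y * ↑U⁻¹, ?_, ?_⟩
  all_goals
    have e1 : 1 - U * a * V * (↑V⁻¹ * x * ↑U⁻¹) = U * (1 - a * x) * ↑U⁻¹ := by
      simp [mul_sub, sub_mul, mul_assoc]
    have e2 : 1 - ↑V⁻¹ * y * ↑U⁻¹ * (U * a * V) = ↑V⁻¹ * (1 - y * a) * V := by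
      simp [mul_sub, sub_mul, mul_assoc]
    intro r
    rw [e1, e2]
  · calc _ = U * ((1 - a * x) * (↑U⁻¹ * r * ↑V⁻¹) * (1 - y * a)) * V := by
          simp only [mul_assoc]
      _ = 0 := by rw [h1, mul_zero, zero_mul]
  · calc _ = ↑V⁻¹ * ((1 - y * a) * (V * r * U) * (1 - a * x)) * ↑U⁻¹ := by
          simp only [mul_assoc]
      _ = 0 := by rw [h2, mul_zero, zero_mul]

theorem isQBRing_iff : IsQBRing R ↔
    ∀ a x b : R, x * a + b = 1 → ∃ y, IsQuasiInvertible (a + y * b) := by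
  simp [IsQBRing, leftCl, Set.eq_univ_iff_forall]

end QuasiInverse

/-! ### Corners -/

section Corner

variable {S T : Type*} [Ring S] [Ring T]

/-- A corner `eTe` of a QB-ring `T` is a QB-ring. The corner is presented as the image of a ring
`S` under an injective additive and multiplicative map `θ` with `θ 1 = e`. -/
theorem IsQBRing.of_corner (hT : IsQBRing T) (θ : S →ₙ+* T) (hθ : Function.Injective θ)
    (hr : ∀ t, ∃ s, θ s = θ 1 * t * θ 1) : IsQBRing S := by
  rw [isQBRing_iff] at hT ⊢
  intro a x b h
  obtain ⟨e, he⟩ : ∃ e, e = θ 1 := ⟨_, rfl⟩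
  rw [← he] at hr
  have hl : ∀ s, e * θ s = θ s := fun s => by rw [he, ← map_mul, one_mul]
  have hl' : ∀ s t, e * (θ s * t) = θ s * t := fun s t => by rw [← mul_assoc, hl]
  have hm : ∀ s, θ s * e = θ s := fun s => by rw [he, ← map_mul, mul_one]
  have hm' : ∀ s t, θ s * (e * t) = θ s * t := fun s t => by rw [← mul_assoc, hm]
  have hee : e * e = e := by rw [he, ← map_mul, one_mul]
  have hee' : ∀ t, e * (e * t) = e * t := fun t => by rw [← mul_assoc, hee]
  have h' : θ x * θ a + θ b = e := by rw [← map_mul, ← map_add, h, he]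
  obtain ⟨y, hy⟩ := hT (θ a + (1 - e)) (θ x + (1 - e)) (θ b) (by
    have : (θ x + (1 - e)) * (θ a + (1 - e)) + θ b = (θ x * θ a + θ b) + (1 - e) := by
      simp only [mul_add, add_mul, mul_sub, sub_mul, hl, hm, hee, mul_one, one_mul]; abel
    rw [this, h']; abel)
  obtain ⟨y0, hy0⟩ := hr y
  -- The block `(1 - e) y b` below the diagonal is cleared by an elementary column operation.
  obtain ⟨c, hc⟩ : ∃ c, c = (1 - e) * (y * θ b) := ⟨_, rfl⟩
  have hac : ∀ s, θ s * c = 0 := fun s => by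
    rw [hc, ← mul_assoc, mul_sub, mul_one, hm, sub_self, zero_mul]
  have hec : e * c = 0 := by rw [hc, ← mul_assoc, mul_sub, mul_one, hee, sub_self, zero_mul]
  have hcc : c * c = 0 := by
    conv_lhs => enter [1]; rw [hc]
    rw [mul_assoc, mul_assoc, hac, mul_zero, mul_zero]
  let V : Tˣ := ⟨1 - c, 1 + c, by simp [mul_add, sub_mul, hcc], by
    simp [mul_sub, add_mul, hcc]⟩
  have hq := hy.units_mul_mul 1 V
  have hval : ((1 : Tˣ) : T) * (θ a + (1 - e) + y * θ b) * V = θ (a + y0 * b) + (1 - e) := by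
    change 1 * (θ a + (1 - e) + y * θ b) * (1 - c) = _
    have e1 : θ (a + y0 * b) = θ a + e * (y * θ b) := by
      rw [map_add, map_mul, hy0]; simp only [mul_assoc, hl]
    rw [e1, one_mul, mul_sub, mul_one, add_mul, add_mul, hac, sub_mul, one_mul, hec, mul_assoc,
      hac, hc, sub_mul, one_mul, mul_zero]
    abel
  rw [hval] at hq
  obtain ⟨w, hw⟩ : ∃ w, w = a + y0 * b := ⟨_, rfl⟩
  rw [← hw] at hq
  refine ⟨y0, ?_⟩
  rw [← hw]
  obtain ⟨α, β, h1, h2⟩ := hq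
  obtain ⟨α', hα⟩ := hr α
  obtain ⟨β', hβ⟩ := hr β
  have e1 : θ (1 - w * α') = e * (1 - (θ w + (1 - e)) * α) * e := by
    rw [map_sub, map_mul, hα, ← he]
    simp only [mul_sub, sub_mul, mul_add, add_mul, mul_assoc, mul_one, one_mul, hee, hl', hm', hee']
    abel
  have e2 : θ (1 - β' * w) = e * (1 - β * (θ w + (1 - e))) * e := by
    rw [map_sub, map_mul, hβ, ← he]
    simp only [mul_sub, sub_mul, mul_add, add_mul, mul_assoc, mul_one, hee, hm, hl]
    abel
  refine ⟨α', β', fun r => hθ ?_, fun r => hθ ?_⟩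
  · rw [map_mul, map_mul, e1, e2, map_zero]
    calc _ = e * ((1 - (θ w + (1 - e)) * α) * (e * θ r * e) * (1 - β * (θ w + (1 - e)))) * e := by
          simp only [mul_assoc]
      _ = 0 := by rw [h1, mul_zero, zero_mul]
  · rw [map_mul, map_mul, e1, e2, map_zero]
    calc _ = e * ((1 - β * (θ w + (1 - e))) * (e * θ r * e) * (1 - (θ w + (1 - e)) * α)) * e := by
          simp only [mul_assoc]
      _ = 0 := by rw [h2, mul_zero, zero_mul]

theorem IsQBRing.of_ringEquiv (hT : IsQBRing T) (f : S ≃+* T) : IsQBRing S :=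
  hT.of_corner (f : S →ₙ+* T) f.injective fun t => ⟨f.symm t, by simp⟩

end Corner

/-! ### Skew corners -/

section SkewCorner

variable {R : Type*} [Ring R]

/-- In a QB-ring, completion to a quasi-invertible element is possible in the skew corner `sRq`,
where `q` is the right defect of `u` and `s` the left defect of `w`. The idea is to apply the
hypothesis to `d + wu`: the summand `wu` identifies the complement of `q` with that of `s` up to the
defects `p` and `t`, which are invisible from the corner because `p ⟂ q` and `s ⟂ t`. -/
theorem IsQBRing.exists_skewCorner (hR : IsQBRing R) {u v p q w z s t : R}
    (hu : IsQuasiInverse u v p q) (hw : IsQuasiInverse w z s t) {d r b : R}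
    (hsd : s * d = d) (hdq : d * q = d) (h : q * r * d + q * b * q = q) :
    ∃ y d' k, d' = d + s * y * q * b * q ∧ q * k = k ∧ k * s = k ∧
      CentrallyOrthogonal (s - d' * k) (q - k * d') := by
  rw [isQBRing_iff] at hR
  have hzd : z * d = 0 := by rw [← hsd, ← mul_assoc, hw.mul_p, zero_mul]
  have hdv : d * v = 0 := by rw [← hdq, mul_assoc, hu.q_mul, mul_zero]
  obtain ⟨y, hy⟩ := hR (d + w * u) (q * r * s + v * z) (q * b * q + v * t * u) (by
    have e1 : q * r * s * d = q * r * d := by rw [mul_assoc _ s, hsd]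
    have e2 : q * r * s * (w * u) = 0 := by
      rw [mul_assoc, ← mul_assoc s, hw.p_mul, zero_mul, mul_zero]
    have e3 : v * z * d = 0 := by rw [mul_assoc, hzd, mul_zero]
    have e4 : v * z * (w * u) = 1 - q - v * t * u := by
      rw [← hu.mul_right]
      calc _ = v * (z * w) * u := by simp only [mul_assoc]
        _ = _ := by rw [hw.mul_right]; noncomm_ring
    rw [mul_add, add_mul, add_mul, e1, e2, e3, e4]
    calc _ = q * r * d + q * b * q + (1 - q) := by abel
      _ = 1 := by rw [h]; abel)
  obtain ⟨β, hβ⟩ : ∃ β, β = q * b * q := ⟨_, rfl⟩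
  rw [← hβ] at hy
  have hβv : β * v = 0 := by rw [hβ, mul_assoc, hu.q_mul, mul_zero]
  have hpβ : ∀ x, p * (x * β) = 0 := fun x => by
    calc _ = p * x * q * (b * q) := by rw [hβ]; simp only [mul_assoc]
      _ = 0 := by rw [hu.pq, zero_mul]
  -- The part of `y` landing in the complement of `s` is cleared by a column operation.
  obtain ⟨f, hf⟩ : ∃ f, f = v * (z * (y * β)) := ⟨_, rfl⟩
  have hβf : β * f = 0 := by rw [hf, ← mul_assoc, hβv, zero_mul]
  have hff : f * f = 0 := by
    conv_lhs => enter [1]; rw [hf]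
    simp only [mul_assoc, hβf, mul_zero]
  let V : Rˣ := ⟨1 - f, 1 + f, by simp [mul_add, sub_mul, hff], by
    simp [mul_sub, add_mul, hff]⟩
  have hq := hy.units_mul_mul 1 V
  obtain ⟨d', hd'⟩ : ∃ d', d' = d + s * y * q * b * q := ⟨_, rfl⟩
  obtain ⟨g, hg⟩ : ∃ g, g = d' + w * ((1 + z * y * v * t) * u) := ⟨_, rfl⟩
  have hval : ((1 : Rˣ) : R) * (d + w * u + y * (β + v * t * u)) * V = g := by
    change 1 * (d + w * u + y * (β + v * t * u)) * (1 - f) = _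
    have huf : u * f = z * (y * β) := by
      rw [hf, ← mul_assoc, hu.mul_left, sub_mul, one_mul, ← mul_assoc z, hpβ, sub_zero]
    have e1 : d * f = 0 := by rw [hf, ← mul_assoc, hdv, zero_mul]
    have e2 : w * u * f = y * β - s * (y * β) := by
      rw [mul_assoc, huf, ← mul_assoc, hw.mul_left, sub_mul, one_mul]
    have e3 : y * (β + v * t * u) * f = 0 := by
      rw [mul_assoc, add_mul, hβf, mul_assoc, huf, mul_assoc, ← mul_assoc t, hw.q_mul, zero_mul,
        mul_zero, zero_add, mul_zero]
    have e4 : s * (y * β) = s * y * q * b * q := by rw [hβ]; simp only [mul_assoc]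
    have e5 : w * (z * y * v * t * u) = y * (v * t * u) := by
      calc _ = w * z * (y * (v * t * u)) := by simp only [mul_assoc]
        _ = y * (v * t * u) - s * (y * v) * t * u := by
          rw [hw.mul_left, sub_mul, one_mul]; simp only [mul_assoc]
        _ = _ := by rw [hw.pq, zero_mul, sub_zero]
    rw [one_mul, mul_sub, mul_one, add_mul, add_mul, e1, e2, e3, hg, hd', e4, add_mul, one_mul,
      mul_add w, e5, mul_add y]
    abel
  rw [hval] at hq
  obtain ⟨l, P, Q, hl⟩ := hq.exists_isQuasiInverse
  have hsd' : s * d' = d' := by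
    rw [hd', mul_add, hsd]
    simp only [← mul_assoc, hw.p_sq]
  have hd'q : d' * q = d' := by
    rw [hd', add_mul, hdq, mul_assoc _ q q, hu.q_sq]
  have hsg : s * g = d' := by
    rw [hg, mul_add, hsd', ← mul_assoc, hw.p_mul, zero_mul, add_zero]
  have hgq : g * q = d' := by
    rw [hg, add_mul, hd'q, mul_assoc, mul_assoc, hu.mul_q, mul_zero, mul_zero, add_zero]
  have k1 : s - d' * (q * l * s) = s * P * s := by
    calc _ = s - (d' * q) * (l * s) := by simp only [mul_assoc]
      _ = s - s * (g * l) * s := by rw [hd'q]; nth_rw 1 [← hsg]; simp only [mul_assoc]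
      _ = _ := by rw [hl.mul_left, mul_sub, sub_mul, mul_one, hw.p_sq]; abel
  have k2 : q - q * l * s * d' = q * Q * q := by
    calc _ = q - (q * l) * (s * d') := by simp only [mul_assoc]
      _ = q - q * (l * g) * q := by rw [hsd']; nth_rw 1 [← hgq]; simp only [mul_assoc]
      _ = _ := by rw [hl.mul_right, mul_sub, sub_mul, mul_one, hu.q_sq]; abel
  refine ⟨y, d', q * l * s, hd', ?_, ?_, fun x => ?_, fun x => ?_⟩
  · simp only [← mul_assoc, hu.q_sq]
  · rw [mul_assoc, hw.p_sq]
  · calc _ = s * (P * (s * x * q) * Q) * q := by rw [k1, k2]; simp only [mul_assoc]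
      _ = 0 := by rw [hl.pq, mul_zero, zero_mul]
  · calc _ = q * (Q * (q * x * s) * P) * s := by rw [k1, k2]; simp only [mul_assoc]
      _ = 0 := by rw [hl.qp, mul_zero, zero_mul]

end SkewCorner

/-! ### Completable pairs and elementary operations -/

section Reduction

variable {R : Type*} [Ring R]

/-- The left ideal generated by `a` and `b` is the whole ring. -/
def LeftUnimodular (a b : R) : Prop := ∃ x z, x * a + z * b = 1

/-- Some `a + yb` is quasi-invertible. -/
def Completable (a b : R) : Prop := ∃ y, IsQuasiInvertible (a + y * b)

theorem isQBRing_iff_completable :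
    IsQBRing R ↔ ∀ a b : R, LeftUnimodular a b → Completable a b := by
  rw [isQBRing_iff]
  constructor
  · rintro h a b ⟨x, z, e⟩
    obtain ⟨y, hy⟩ := h a x (z * b) e
    exact ⟨y * z, by rwa [mul_assoc]⟩
  · rintro h a x b e
    exact h a b ⟨x, 1, by rwa [one_mul]⟩

/-- To complete the left unimodular pair `(a, b)` it is enough to complete `(a', b')`, which is
again left unimodular. -/
def Reduces (a b a' b' : R) : Prop :=
  (LeftUnimodular a b → LeftUnimodular a' b') ∧ (Completable a' b' → Completable a b)

theorem Reduces.trans {a b a' b' a'' b'' : R} (h : Reduces a b a' b')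
    (h' : Reduces a' b' a'' b'') : Reduces a b a'' b'' :=
  ⟨fun k => h'.1 (h.1 k), fun k => h.2 (h'.2 k)⟩

theorem reduces_add (a b y : R) : Reduces a b (a + y * b) b := by
  constructor
  · rintro ⟨x, z, e⟩
    exact ⟨x, z - x * y, by rw [← e]; noncomm_ring⟩
  · rintro ⟨y', h⟩
    exact ⟨y + y', by rwa [add_mul, ← add_assoc]⟩

theorem reduces_units (a b : R) (U V : Rˣ) : Reduces a b (U * a * V) (b * V) := by
  constructor
  · rintro ⟨x, z, e⟩
    refine ⟨↑V⁻¹ * x * ↑U⁻¹, ↑V⁻¹ * z, ?_⟩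
    calc _ = ↑V⁻¹ * (x * a + z * b) * V := by simp [mul_add, add_mul, mul_assoc]
      _ = 1 := by rw [e]; simp
  · rintro ⟨y, h⟩
    refine ⟨↑U⁻¹ * y, ?_⟩
    convert h.units_mul_mul U⁻¹ V⁻¹ using 1
    simp [mul_add, add_mul, mul_assoc]

theorem reduces_of_eq {a b a' : R} (y : R) (U V : Rˣ) (h : U * (a + y * b) * V = a') :
    Reduces a b a' (b * V) :=
  h ▸ (reduces_add a b y).trans (reduces_units _ b U V)

end Reduction

/-! ### Two-by-two matrices over a QB-ring -/

section MatrixTwo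

variable {R : Type*} [Ring R]

/-- The elementary matrix with entry `x` below the diagonal, as a unit. -/
def lowerUnit (x : R) : (Matrix (Fin 2) (Fin 2) R)ˣ where
  val := !![1, 0; x, 1]
  inv := !![1, 0; -x, 1]
  val_inv := by simp [Matrix.one_fin_two]
  inv_val := by simp [Matrix.one_fin_two]

/-- The elementary matrix with entry `x` above the diagonal, as a unit. -/
def upperUnit (x : R) : (Matrix (Fin 2) (Fin 2) R)ˣ where
  val := !![1, x; 0, 1]
  inv := !![1, -x; 0, 1]
  val_inv := by simp [Matrix.one_fin_two]
  inv_val := by simp [Matrix.one_fin_two]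

/-- The transposition matrix, as a unit. -/
def swapUnit : (Matrix (Fin 2) (Fin 2) R)ˣ where
  val := !![0, 1; 1, 0]
  inv := !![0, 1; 1, 0]
  val_inv := by simp [Matrix.one_fin_two]
  inv_val := by simp [Matrix.one_fin_two]

theorem coe_lowerUnit (x : R) : (lowerUnit x : Matrix (Fin 2) (Fin 2) R) = !![1, 0; x, 1] := rfl
theorem coe_upperUnit (x : R) : (upperUnit x : Matrix (Fin 2) (Fin 2) R) = !![1, x; 0, 1] := rfl
theorem coe_swapUnit : ((swapUnit : (Matrix (Fin 2) (Fin 2) R)ˣ) : Matrix (Fin 2) (Fin 2) R) =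
    !![0, 1; 1, 0] := rfl

theorem reduces_swap (a b c d : R) (B : Matrix (Fin 2) (Fin 2) R) :
    ∃ B', Reduces !![a, b; c, d] B !![d, c; b, a] B' := by
  refine ⟨_, reduces_of_eq 0 swapUnit swapUnit ?_⟩
  rw [zero_mul, add_zero, coe_swapUnit]
  simp

/-- Left unimodularity of a pair of two-by-two matrices, read off on the diagonal; the
`nᵢⱼ` are the entries of a left multiple of `B`. -/
theorem LeftUnimodular.exists_entries {a b c d : R} {B : Matrix (Fin 2) (Fin 2) R}
    (h : LeftUnimodular !![a, b; c, d] B) : ∃ (Z : Matrix (Fin 2) (Fin 2) R) (x y x' y' : R)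
      (n00 n01 n10 n11 : R), Z * B = !![n00, n01; n10, n11] ∧
      x * a + y * c + n00 = 1 ∧ x' * b + y' * d + n11 = 1 := by
  obtain ⟨X, Z, h⟩ := h
  refine ⟨Z, X 0 0, X 0 1, X 1 0, X 1 1, (Z * B) 0 0, (Z * B) 0 1, (Z * B) 1 0, (Z * B) 1 1,
    Matrix.eta_fin_two _, ?_, ?_⟩
  · have := congrFun (congrFun h 0) 0
    rw [Matrix.add_apply, Matrix.mul_apply] at this
    simpa using this
  · have := congrFun (congrFun h 1) 1
    rw [Matrix.add_apply, Matrix.mul_apply] at this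
    simpa using this

/-- The upper left entry is made quasi-invertible; the entries next to it can then only be moved
into `pR` and `Rq`. -/
theorem reduces_quasiInverse_first (hR : IsQBRing R) {A B : Matrix (Fin 2) (Fin 2) R}
    (h : LeftUnimodular A B) : ∃ u v p q c d e B', IsQuasiInverse u v p q ∧
      Reduces A B !![u, p * c; d * q, e] B' := by
  obtain ⟨a, c, d, e, rfl⟩ : ∃ a c d e, A = !![a, c; d, e] := ⟨_, _, _, _, Matrix.eta_fin_two A⟩
  obtain ⟨Z, x, r, -, -, n00, n01, n10, n11, hZ, h0, -⟩ := h.exists_entries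
  rw [isQBRing_iff] at hR
  obtain ⟨y, hy⟩ := hR a x (r * d + n00) (by rw [← add_assoc, h0])
  obtain ⟨u, hu⟩ : ∃ u, u = a + y * (r * d + n00) := ⟨_, rfl⟩
  rw [← hu] at hy
  obtain ⟨v, p, q, huv⟩ := hy.exists_isQuasiInverse
  obtain ⟨c', hc'⟩ : ∃ c', c' = c + y * n01 + y * r * e := ⟨_, rfl⟩
  obtain ⟨B₁, h1⟩ : ∃ B₁, Reduces !![a, c; d, e] B !![u, c'; d, e] B₁ := by
    refine ⟨_, reduces_of_eq (!![y, 0; 0, 0] * Z) (upperUnit (y * r)) 1 ?_⟩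
    rw [mul_assoc _ Z B, hZ, coe_upperUnit, hu, hc']
    simp [mul_add, mul_assoc, add_assoc, add_comm]
  refine ⟨u, v, p, q, c', d, e - d * v * c', _, huv, h1.trans
    (reduces_of_eq 0 (lowerUnit (-(d * v))) (upperUnit (-(v * c'))) ?_)⟩
  have e1 : u * (v * c') = c' - p * c' := by
    rw [← mul_assoc, huv.mul_left, sub_mul, one_mul]
  have e2 : d * (v * u) = d - d * q := by rw [huv.mul_right, mul_sub, mul_one]
  rw [coe_lowerUnit, coe_upperUnit]
  simp [mul_assoc, e1, e2]
  simp [← mul_assoc, huv.q_mul]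
  abel

/-- The lower right entry is made quasi-invertible while the shape of the first row and column is
kept. -/
theorem reduces_quasiInverse_second (hR : IsQBRing R) {u v p q c d e : R}
    {B : Matrix (Fin 2) (Fin 2) R} (huv : IsQuasiInverse u v p q)
    (h : LeftUnimodular !![u, p * c; d * q, e] B) : ∃ w z s t d' B', IsQuasiInverse w z s t ∧
      Reduces !![u, p * c; d * q, e] B !![u, p * c; d' * q, w] B' := by
  obtain ⟨Z, -, -, r, x, n00, n01, n10, n11, hZ, -, h1⟩ := h.exists_entries
  rw [isQBRing_iff] at hR
  obtain ⟨y, hy⟩ := hR e x (r * (p * c) + n11) (by rw [← h1]; abel)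
  obtain ⟨w, hw⟩ : ∃ w, w = e + y * (r * (p * c) + n11) := ⟨_, rfl⟩
  rw [← hw] at hy
  obtain ⟨z, s, t, hwz⟩ := hy.exists_isQuasiInverse
  obtain ⟨m, hm⟩ : ∃ m, m = d * q + y * n10 := ⟨_, rfl⟩
  -- The row operations keep the first column in `Rq` because `pu = 0` and `vp = 0`.
  refine ⟨w, z, s, t, m, _, hwz,
    reduces_of_eq (!![0, 0; 0, y] * Z) (lowerUnit (y * r * p - m * v)) 1 ?_⟩
  have e1 : (y * r * p - m * v) * u + m = m * q := by
    rw [sub_mul, mul_assoc _ p, huv.p_mul, mul_assoc m, huv.mul_right]; noncomm_ring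
  have e2 : (y * r * p - m * v) * (p * c) + (e + y * n11) = w := by
    rw [hw, sub_mul]
    have a1 : m * v * (p * c) = 0 := by
      rw [mul_assoc, ← mul_assoc v, huv.mul_p, zero_mul, mul_zero]
    have a2 : y * r * p * (p * c) = y * (r * (p * c)) := by
      rw [mul_assoc, ← mul_assoc p, huv.p_sq]; simp only [mul_assoc]
    rw [a1, a2, mul_add]; abel
  rw [mul_assoc _ Z B, hZ, coe_lowerUnit]
  simp [← hm, e1, e2]

/-- The off-diagonal entries move into the skew corners `pRt` and `sRq`; the diagonal does not change
because `p ⟂ q`. -/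
theorem reduces_skewCorners {u v p q w z s t : R} (huv : IsQuasiInverse u v p q)
    (hwz : IsQuasiInverse w z s t) (c d : R) (B : Matrix (Fin 2) (Fin 2) R) :
    ∃ B', Reduces !![u, p * c; d * q, w] B !![u, p * c * t; s * d * q, w] B' := by
  refine ⟨_, reduces_of_eq 0 (upperUnit (-(p * c * z))) (lowerUnit (-(z * d * q))) ?_⟩
  have e1 : p * c * z * (d * q) = 0 := by
    calc _ = p * (c * z * d) * q := by simp only [mul_assoc]
      _ = 0 := huv.pq _
  have e2 : p * c * z * w = p * c - p * c * t := by rw [mul_assoc, hwz.mul_right, mul_sub, mul_one]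
  have e3 : p * c * t * (z * d * q) = 0 := by
    calc _ = p * c * (t * z) * d * q := by simp only [mul_assoc]
      _ = 0 := by rw [hwz.q_mul]; simp
  have e4 : w * (z * d * q) = d * q - s * d * q := by
    calc _ = w * z * (d * q) := by simp only [mul_assoc]
      _ = _ := by rw [hwz.mul_left]; noncomm_ring
  rw [coe_upperUnit, coe_lowerUnit]
  simp [e1, e2, e3, e4]

theorem reduces_quasiInverse_skewCorner (hR : IsQBRing R) {u v p q w z s t c d : R}
    {B : Matrix (Fin 2) (Fin 2) R} (huv : IsQuasiInverse u v p q) (hwz : IsQuasiInverse w z s t)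
    (hpc : p * c = c) (hsd : s * d = d) (hdq : d * q = d)
    (h : LeftUnimodular !![u, c; d, w] B) : ∃ d' k B', s * d' = d' ∧ d' * q = d' ∧
      q * k = k ∧ k * s = k ∧ CentrallyOrthogonal (s - d' * k) (q - k * d') ∧
      Reduces !![u, c; d, w] B !![u, c; d', w] B' := by
  obtain ⟨Z, x, r, -, -, n00, n01, n10, n11, hZ, h0, -⟩ := h.exists_entries
  have h0' : q * r * d + q * n00 * q = q := by
    calc _ = q * (x * u + r * d + n00) * q - q * x * (u * q) := by
            nth_rw 1 [← hdq]; noncomm_ring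
      _ = q := by rw [h0, huv.mul_q, mul_one, huv.q_sq, mul_zero, sub_zero]
  obtain ⟨y, d', k, hd', hqk, hks, horth⟩ := hR.exists_skewCorner huv hwz hsd hdq h0'
  have hss : ∀ a, s * (s * a) = s * a := fun a => by rw [← mul_assoc, hwz.p_sq]
  have hzs : ∀ a, z * (s * a) = 0 := fun a => by rw [← mul_assoc, hwz.mul_p, zero_mul]
  have hvc : v * c = 0 := by rw [← hpc, ← mul_assoc, huv.mul_p, zero_mul]
  have hzd : z * d = 0 := by rw [← hsd, hzs]
  obtain ⟨m, hm⟩ : ∃ m, m = s * (y * (q * n00)) := ⟨_, rfl⟩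
  obtain ⟨n, hn⟩ : ∃ n, n = s * (y * (q * n01)) := ⟨_, rfl⟩
  have hzm : z * m = 0 := by rw [hm, hzs]
  have hzn : z * n = 0 := by rw [hn, hzs]
  have hnt : n * t = 0 := by
    rw [hn]
    calc _ = s * (y * (q * n01)) * t := by simp only [mul_assoc]
      _ = 0 := hwz.pq _
  have hd'm : d' = d + m * q := by rw [hd', hm]; simp only [mul_assoc]
  -- Adding `s y q` times the first row of `Z * B` to the second row makes the entry `d`
  -- quasi-invertible in its corner; the operation `U` then restores the entry `w`.
  let U : (Matrix (Fin 2) (Fin 2) R)ˣ :=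
    ⟨!![1, 0; -(m * v), 1 - n * z], !![1, 0; m * v, 1 + n * z], by
      simp [Matrix.one_fin_two, mul_add, sub_mul, mul_assoc, ← mul_assoc z, hzm, hzn], by
      simp [Matrix.one_fin_two, mul_sub, add_mul, mul_assoc, ← mul_assoc z, hzm, hzn]⟩
  refine ⟨d', k, _, ?_, ?_, hqk, hks, horth,
    reduces_of_eq (!![0, 0; s * (y * q), 0] * Z) U 1 ?_⟩
  · rw [hd'm, hm, mul_add, hsd]; simp only [mul_assoc, hss]
  · rw [hd'm, add_mul, hdq, mul_assoc, huv.q_sq]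
  · have e1 : -(m * (v * u)) + (1 - n * z) * (d + m) = d' := by
      rw [huv.mul_right, sub_mul, mul_assoc, mul_add z, hzd, hzm, hd'm]; noncomm_ring
    have e2 : (1 - n * z) * (w + n) = w := by
      rw [sub_mul, mul_assoc, mul_add z, hzn, hwz.mul_right, add_zero, mul_sub, hnt]; noncomm_ring
    rw [mul_assoc _ Z B, hZ]
    change !![1, 0; -(m * v), 1 - n * z] * _ * 1 = _
    simp [mul_assoc, ← hm, ← hn, hvc, e1, e2]

/-- If all four entries are quasi-invertible, the off-diagonal ones in the skew corners given by the
defects of the diagonal ones, then so is the matrix: the transposed array of their quasi-inverses is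
a quasi-inverse. -/
theorem isQuasiInvertible_fin_two {u v p q w z s t c d k l : R} (huv : IsQuasiInverse u v p q)
    (hwz : IsQuasiInverse w z s t) (hpc : p * c = c) (hct : c * t = c) (htl : t * l = l)
    (hlp : l * p = l) (hsd : s * d = d) (hdq : d * q = d) (hqk : q * k = k) (hks : k * s = k)
    (hc : CentrallyOrthogonal (p - c * l) (t - l * c))
    (hd : CentrallyOrthogonal (s - d * k) (q - k * d)) :
    IsQuasiInvertible !![u, c; d, w] := by
  have a1 : u * k = 0 := by rw [← hqk, ← mul_assoc, huv.mul_q, zero_mul]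
  have a2 : c * z = 0 := by rw [← hct, mul_assoc, hwz.q_mul, mul_zero]
  have a3 : d * v = 0 := by rw [← hdq, mul_assoc, huv.q_mul, mul_zero]
  have a4 : w * l = 0 := by rw [← htl, ← mul_assoc, hwz.mul_q, zero_mul]
  have b1 : v * c = 0 := by rw [← hpc, ← mul_assoc, huv.mul_p, zero_mul]
  have b2 : k * w = 0 := by rw [← hks, mul_assoc, hwz.p_mul, mul_zero]
  have b3 : l * u = 0 := by rw [← hlp, mul_assoc, huv.p_mul, mul_zero]
  have b4 : z * d = 0 := by rw [← hsd, ← mul_assoc, hwz.mul_p, zero_mul]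
  have e1 : 1 - !![u, c; d, w] * !![v, k; l, z] = !![p - c * l, 0; 0, s - d * k] := by
    ext i j
    fin_cases i <;> fin_cases j <;> simp [a1, a2, a3, a4, huv.mul_left, hwz.mul_left]
    all_goals abel
  have e2 : 1 - !![v, k; l, z] * !![u, c; d, w] = !![q - k * d, 0; 0, t - l * c] := by
    ext i j
    fin_cases i <;> fin_cases j <;> simp [b1, b2, b3, b4, huv.mul_right, hwz.mul_right]
    all_goals abel
  have hp : p - c * l = p * (1 - c * l) := by rw [mul_sub, mul_one, ← mul_assoc, hpc]
  have hp' : p - c * l = (1 - c * l) * p := by rw [sub_mul, one_mul, mul_assoc, hlp]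
  have hs : s - d * k = s * (1 - d * k) := by rw [mul_sub, mul_one, ← mul_assoc, hsd]
  have hs' : s - d * k = (1 - d * k) * s := by rw [sub_mul, one_mul, mul_assoc, hks]
  have hq : q - k * d = q * (1 - k * d) := by rw [mul_sub, mul_one, ← mul_assoc, hqk]
  have hq' : q - k * d = (1 - k * d) * q := by rw [sub_mul, one_mul, mul_assoc, hdq]
  have ht : t - l * c = t * (1 - l * c) := by rw [mul_sub, mul_one, ← mul_assoc, htl]
  have ht' : t - l * c = (1 - l * c) * t := by rw [sub_mul, one_mul, mul_assoc, hct]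
  have o1 : ∀ r, (p - c * l) * r * (q - k * d) = 0 := fun r => by
    calc _ = (1 - c * l) * (p * r * q) * (1 - k * d) := by rw [hp', hq]; simp only [mul_assoc]
      _ = 0 := by rw [huv.pq, mul_zero, zero_mul]
  have o2 : ∀ r, (q - k * d) * r * (p - c * l) = 0 := fun r => by
    calc _ = (1 - k * d) * (q * r * p) * (1 - c * l) := by rw [hq', hp]; simp only [mul_assoc]
      _ = 0 := by rw [huv.qp, mul_zero, zero_mul]
  have o3 : ∀ r, (s - d * k) * r * (t - l * c) = 0 := fun r => by
    calc _ = (1 - d * k) * (s * r * t) * (1 - l * c) := by rw [hs', ht]; simp only [mul_assoc]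
      _ = 0 := by rw [hwz.pq, mul_zero, zero_mul]
  have o4 : ∀ r, (t - l * c) * r * (s - d * k) = 0 := fun r => by
    calc _ = (1 - l * c) * (t * r * s) * (1 - d * k) := by rw [ht', hs]; simp only [mul_assoc]
      _ = 0 := by rw [hwz.qp, mul_zero, zero_mul]
  refine ⟨!![v, k; l, z], !![v, k; l, z], fun r => ?_, fun r => ?_⟩
  · rw [e1, e2, Matrix.eta_fin_two r]
    simp [o1, o3, hc.1 _, hd.1 _]
    exact (Matrix.eta_fin_two 0).symm
  · rw [e1, e2, Matrix.eta_fin_two r]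
    simp [o2, o4, hc.2 _, hd.2 _]
    exact (Matrix.eta_fin_two 0).symm

theorem IsQBRing.matrix_fin_two (hR : IsQBRing R) : IsQBRing (Matrix (Fin 2) (Fin 2) R) := by
  rw [isQBRing_iff_completable]
  intro A B h
  obtain ⟨u, v, p, q, c, d, e, B₁, huv, r₁⟩ := reduces_quasiInverse_first hR h
  obtain ⟨w, z, s, t, d, B₂, hwz, r₂⟩ := reduces_quasiInverse_second hR huv (r₁.1 h)
  obtain ⟨B₃, r₃⟩ := reduces_skewCorners huv hwz c d B₂
  have r₃ := (r₁.trans r₂).trans r₃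
  have hpc : p * (p * c * t) = p * c * t := by rw [← mul_assoc, ← mul_assoc, huv.p_sq]
  obtain ⟨d', k, B₄, hsd', hdq', hqk, hks, hd, r₄⟩ := reduces_quasiInverse_skewCorner hR huv hwz
    hpc (by simp only [← mul_assoc, hwz.p_sq])
    (by rw [mul_assoc, huv.q_sq]) (r₃.1 h)
  obtain ⟨B₅, r₅⟩ := reduces_swap u (p * c * t) d' w B₄
  have r₅ := (r₃.trans r₄).trans r₅
  obtain ⟨c', l, B₆, hpc', hct', htl, hlp, hc, r₆⟩ := reduces_quasiInverse_skewCorner hR hwz huv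
    hsd' hpc (by rw [mul_assoc, hwz.q_sq]) (r₅.1 h)
  exact (r₅.trans r₆).2 ⟨0, by
    simpa using isQuasiInvertible_fin_two hwz huv hsd' hdq' hqk hks hpc' hct' htl hlp hd hc⟩

end MatrixTwo

/-! ### Square matrices of any size -/

section Matrix

variable {R : Type*} [Ring R]

theorem IsQBRing.matrix_of_embedding {ι κ : Type*} [Fintype ι] [DecidableEq ι] [Fintype κ]
    [DecidableEq κ] (f : ι ↪ κ) (h : IsQBRing (Matrix κ κ R)) : IsQBRing (Matrix ι ι R) := by
  -- The rectangular matrix `F` of `f` satisfies `Fᵀ F = 1`.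
  obtain ⟨F, hF⟩ : ∃ F : Matrix κ ι R, F = Matrix.of fun k i => if k = f i then 1 else 0 := ⟨_, rfl⟩
  obtain ⟨G, hG⟩ : ∃ G : Matrix ι κ R, G = Matrix.of fun i k => if k = f i then 1 else 0 := ⟨_, rfl⟩
  have hGF : G * F = 1 := by
    ext i j
    simp [hF, hG, Matrix.mul_apply, Matrix.one_apply, eq_comm]
  have hGF' : ∀ M : Matrix ι κ R, G * (F * M) = M := fun M => by
    rw [← Matrix.mul_assoc, hGF, Matrix.one_mul]
  let θ : Matrix ι ι R →ₙ+* Matrix κ κ R :=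
    { toFun M := F * M * G
      map_zero' := by simp
      map_add' M N := by simp [Matrix.mul_add, Matrix.add_mul]
      map_mul' M N := by simp only [Matrix.mul_assoc, hGF'] }
  have hθ : ∀ M, θ M = F * M * G := fun _ => rfl
  refine h.of_corner θ (fun M N hMN => ?_) fun t => ⟨G * t * F, ?_⟩
  · have := congrArg (fun X => G * X * F) hMN
    simpa only [hθ, Matrix.mul_assoc, hGF, hGF', Matrix.mul_one] using this
  · simp only [hθ, Matrix.mul_assoc, Matrix.one_mul]

theorem IsQBRing.matrix_fin (hR : IsQBRing R) : ∀ n, IsQBRing (Matrix (Fin n) (Fin n) R)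
  | 0 => hR.matrix_fin_two.matrix_of_embedding (Fin.castLEEmb (by omega))
  | 1 => hR.matrix_fin_two.matrix_of_embedding (Fin.castLEEmb (by omega))
  | n + 2 => by
    have h : IsQBRing (Matrix (Fin 2 × Fin (n + 1)) (Fin 2 × Fin (n + 1)) R) :=
      (hR.matrix_fin (n + 1)).matrix_fin_two.of_ringEquiv
        (Matrix.compRingEquiv (Fin 2) (Fin (n + 1)) R).symm
    exact h.matrix_of_embedding
      ((Fin.castLEEmb (by omega)).trans finProdFinEquiv.symm.toEmbedding)

end Matrix

/-! ### Morita equivalence -/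

section Morita

open CategoryTheory

section Category

variable {C : Type*} [Category C] [Preadditive C]

/-- If the identity of `X` factors as a finite sum of maps through `Y`, the ring `End X` is a corner
of a matrix ring over `End Y`. The rings are given with multiplication in diagrammatic order, by
the bijections `α` and `β`. -/
theorem IsQBRing.of_sum_comp_eq_id {R S : Type*} [Ring R] [Ring S] (hR : IsQBRing R) {X Y : C}
    (α : S ≃+ (X ⟶ X)) (hα : ∀ a b, α (a * b) = α a ≫ α b) (hα1 : α 1 = 𝟙 X)
    (β : R ≃+ (Y ⟶ Y)) (hβ : ∀ a b, β (a * b) = β a ≫ β b)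
    {n : ℕ} (f : Fin n → (X ⟶ Y)) (g : Fin n → (Y ⟶ X)) (h : ∑ i, f i ≫ g i = 𝟙 X) :
    IsQBRing S := by
  have hβ' : ∀ a b, β.symm a * β.symm b = β.symm (a ≫ b) := fun a b => by
    apply β.injective; simp [hβ]
  have key : ∀ {Z W : C} (a : Z ⟶ X) (b : X ⟶ W), ∑ k, a ≫ f k ≫ g k ≫ b = a ≫ b := by
    intro Z W a b
    calc _ = a ≫ (∑ k, f k ≫ g k) ≫ b := by simp [Preadditive.sum_comp, Preadditive.comp_sum]
      _ = _ := by rw [h, Category.id_comp]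
  let θ : S →ₙ+* Matrix (Fin n) (Fin n) R :=
    { toFun s := Matrix.of fun i j => β.symm (g i ≫ α s ≫ f j)
      map_zero' := by ext; simp
      map_add' s t := by ext; simp
      map_mul' s t := by
        ext i j
        simp only [Matrix.mul_apply, Matrix.of_apply, hβ', ← map_sum, hα, Category.assoc]
        have := key (g i ≫ α s) (α t ≫ f j)
        simp only [Category.assoc] at this
        rw [this] }
  have hθ : ∀ s i j, θ s i j = β.symm (g i ≫ α s ≫ f j) := fun _ _ _ => rfl
  -- An endomorphism of `X` is recovered from its matrix.
  have hrec : ∀ s, ∑ i, ∑ j, f i ≫ β (θ s i j) ≫ g j = α s := fun s => by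
    simp only [hθ, AddEquiv.apply_symm_apply, Category.assoc]
    have := fun i => key (f i ≫ g i ≫ α s) (𝟙 X)
    simp only [Category.assoc, Category.comp_id] at this
    simp only [this]
    simpa using key (𝟙 X) (α s)
  refine (hR.matrix_fin n).of_corner θ (fun s t hst => ?_) fun t => ?_
  · apply α.injective
    rw [← hrec s, ← hrec t, hst]
  · refine ⟨α.symm (∑ i, ∑ j, f i ≫ β (t i j) ≫ g j), ?_⟩
    ext i j
    simp only [Matrix.mul_apply, hθ, hα1, Category.id_comp, AddEquiv.apply_symm_apply]
    apply β.injective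
    simp only [map_sum, hβ, AddEquiv.apply_symm_apply, Finset.sum_mul, Preadditive.sum_comp,
      Preadditive.comp_sum, Category.assoc]
    exact Finset.sum_comm

end Category

/-- The endomorphisms of the regular module are the right multiplications. The lift adjusts the
universe level. -/
noncomputable def endRegular (R : Type u) [Ring R] :
    R ≃+ (ModuleCat.of R (ULift.{v} R) ⟶ ModuleCat.of R (ULift.{v} R)) where
  toFun r := ModuleCat.ofHom
    { toFun x := ⟨x.down * r⟩
      map_add' x y := by ext; simp [add_mul]
      map_smul' a x := by ext; simp [mul_assoc] }
  invFun f := (f.hom ⟨1⟩).down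
  left_inv r := by simp
  right_inv f := by
    ext x
    have := f.hom.map_smul x.down ⟨1⟩
    have e : x.down • (⟨1⟩ : ULift.{v} R) = x := by ext; simp
    rw [e] at this
    rw [this]
    rfl
  map_add' r s := by ext x; simp [mul_add]

theorem endRegular_mul (R : Type u) [Ring R] (r s : R) :
    endRegular.{u, v} R (r * s) = endRegular.{u, v} R r ≫ endRegular.{u, v} R s := by
  ext x
  exact (mul_assoc x.down r s).symm

theorem endRegular_one (R : Type u) [Ring R] : endRegular.{u, v} R 1 = 𝟙 _ := by
  ext x
  exact mul_one x.down

/-- If `M` is a generator, its trace ideal is the whole ring, so the identity of the regular module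
is a finite sum of endomorphisms that factor through `M`. -/
theorem exists_sum_comp_eq_id {S : Type u} [Ring S] {M : ModuleCat.{max u v} S}
    (hM : IsSeparator M) :
    ∃ (n : ℕ) (f : Fin n → (ModuleCat.of S (ULift.{v} S) ⟶ M))
      (g : Fin n → (M ⟶ ModuleCat.of S (ULift.{v} S))), ∑ i, f i ≫ g i = 𝟙 _ := by
  obtain ⟨T, hT⟩ : ∃ T : Submodule S (ULift.{v} S), T = Submodule.span S
    {x | ∃ (g : M ⟶ ModuleCat.of S (ULift.{v} S)) (m : M), g.hom m = x} := ⟨_, rfl⟩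
  have hq : ModuleCat.ofHom T.mkQ = 0 := by
    refine (Preadditive.isSeparator_iff M).1 hM _ fun g => ?_
    ext m
    simp only [ModuleCat.hom_comp, ModuleCat.hom_ofHom, LinearMap.comp_apply, ModuleCat.hom_zero,
      LinearMap.zero_apply, Submodule.mkQ_apply, Submodule.Quotient.mk_eq_zero]
    rw [hT]
    exact Submodule.subset_span ⟨g, m, rfl⟩
  have h1 : (⟨1⟩ : ULift.{v} S) ∈ T := by
    have := congrArg (fun φ => φ.hom (⟨1⟩ : ULift.{v} S)) hq
    simpa using this
  rw [hT, Submodule.mem_span_set'] at h1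
  obtain ⟨n, c, x, hx⟩ := h1
  choose g m hgm using fun i => (x i).2
  refine ⟨n, fun i => ModuleCat.ofHom
    { toFun y := y.down • c i • m i
      map_add' y z := by simp [add_smul]
      map_smul' a y := by simp [mul_smul] }, g, ?_⟩
  ext y
  have e : y.down • (⟨1⟩ : ULift.{v} S) = y := by ext; simp
  simp only [ModuleCat.hom_sum, ModuleCat.hom_comp, ModuleCat.hom_ofHom, LinearMap.sum_apply,
    LinearMap.comp_apply, LinearMap.coe_mk, AddHom.coe_mk, map_smul, hgm, ModuleCat.hom_id,
    LinearMap.id_apply]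
  rw [← Finset.smul_sum, hx, e]

theorem isSeparator_regular (R : Type u) [Ring R] :
    IsSeparator (ModuleCat.of R (ULift.{v} R) : ModuleCat.{max u v} R) := by
  rw [Preadditive.isSeparator_iff]
  intro X Y f hf
  ext x
  have := hf (ModuleCat.ofHom
    { toFun y := y.down • x
      map_add' y z := by simp [add_smul]
      map_smul' a y := by simp [mul_smul] })
  simpa using congrArg (fun φ => φ.hom (⟨1⟩ : ULift.{v} R)) this

end Morita

/-- A unital ring `S` that is Morita equivalent to a unital QB-ring `R` is a QB-ring. Morita
equivalence is Mathlib's notion over `ℤ`: an additive equivalence between the categories of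
(left) modules. -/
theorem corollary6p6 {R : Type u} [Ring R] {S : Type v} [Ring S]
    (hR : IsQBRing R) (hSR : IsMoritaEquivalent ℤ S R) : IsQBRing S := by
  obtain ⟨e⟩ := hSR.cond
  let F := e.eqv.inverse
  have : F.Additive := e.eqv.inverse_additive
  let U : ModuleCat.{max v u} R := ModuleCat.of R (ULift.{v} R)
  obtain ⟨n, f, g, h⟩ := exists_sum_comp_eq_id (M := F.obj U)
    ((isSeparator_regular R).of_equivalence e.eqv.symm)
  let β : R ≃+ (F.obj U ⟶ F.obj U) :=
    (endRegular.{u, v} R).trans (AddEquiv.ofBijective (F.mapAddHom (X := U) (Y := U))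
      ⟨F.map_injective, F.map_surjective⟩)
  refine hR.of_sum_comp_eq_id (endRegular.{v, u} S) (endRegular_mul S) (endRegular_one S)
    β (fun a b => (congrArg F.map (endRegular_mul R a b)).trans (F.map_comp _ _)) f g h
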